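/- Let $E$ be a finite set and let $X=(X_t)_{t\ge 0}$ be a right-continuous time-homogeneous continuous-time Markov chain with values in $E$, with probability measures $(\mathbb P_x)_{x\in E}$ such that $\mathbb P_x(X_0=x)=1$ and with Markov generator $Q=(Q(x,y))_{x,y\in E}$. For $f\in\mathbb R^E$ put $\mathcal Q[f](x)=\sum_{y\in E}Q(x,y)f(y)$. Let $\beta>0$ and let $\psi,\phi\in\mathbb R^E$ with $0\le\psi\le\phi$. Stopping times are $[0,\infty]$-valued and refer to the natural filtration of $X$. For stopping times $\tau,\gamma$ let $$R_x(\tau,\gamma)=\mathbb E_x\big[e^{-\beta\tau}\psi(X_\tau)\mathbf 1_{\{\tau\le\gamma\}}+e^{-\beta\gamma}\phi(X_\gamma)\mathbf 1_{\{\tau>\gamma\}}\big],$$ where $e^{-\beta\eta}f(X_\eta)=0$ on $\{\eta=\infty\}$. A function $V$ is the value function if $V(x)=\inf_\gamma\sup_\tau R_x(\tau,\gamma)=\sup_\tau\inf_\gamma R_x(\tau,\gamma)$ for all $x\in E$. For $A\subset E$ let $h(A)=\inf\{t\ge 0: X_t\in A\}$. Define $V_0(x)=\sup_\tau\mathbb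 E_x[e^{-\beta\tau}\psi(X_\tau)]$, $S_1=\{V_0>\phi\}\cup\{\phi=\psi\}$ and, for $k\ge 1$, $$V_k(x)=\sup_\tau R_x(\tau,h(S_k)),\qquad S_{k+1}=\big(S_k\cap\{\mathcal Q[V_k]-\beta V_k\ge 0\}\big)\cup\{\phi=\psi\}.$$ For each $k\ge1$ let $D_k^{(1)}=\{\mathcal Q[\psi]-\beta\psi\le 0\}\cap S_k^c$ and, for $n\ge 1$, $$V_k^{(n)}(x)=R_x\big(h(D_k^{(n)}),h(S_k)\big),\qquad D_k^{(n+1)}=\{\mathcal Q[V_k^{(n)}]-\beta V_k^{(n)}\le 0\}\cap D_k^{(n)},$$ and set $D_k=\bigcap_{n\ge1}D_k^{(n)}$, $D_\infty=\bigcup_{k\ge1}D_k$, $S_\infty=\bigcap_{k\ge1}S_k$. Then the game has a value function $V$, and there exist disjoint sets $A,B\subset E$, both disjoint from $\{\phi=\psi\}$, namely $A=D_\infty$ and $B=S_\infty\cap\{\phi>\psi\}$, such that $$\begin{cases}\forall x\in A,& \mathcal Q[V](x)-\beta V(x)\le 0\ \text{ and }\ V(x)=\psi(x),\\ \forall x\in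 B,& \mathcal Q[V](x)-\beta V(x)\ge 0\ \text{ and }\ V(x)=\phi(x),\\ \forall x\notin A\cup B\cup\{\phi=\psi\},& \mathcal Q[V](x)-\beta V(x)=0,\\ \forall x\in E,& \psi(x)\le V(x)\le\phi(x).\end{cases}$$ -/

import Mathlib

open MeasureTheory ProbabilityTheory Filter Topology
open scoped NNReal Matrix

namespace StoppingGame

/-- A Markov generator on `E`: non-negative off-diagonal entries and vanishing row sums. -/
structure IsMarkovGenerator {E : Type*} [Fintype E] (Q : Matrix E E ℝ) : Prop where
  nonneg_offDiag : ∀ x y, x ≠ y → 0 ≤ Q x y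
  row_sum_zero : ∀ x, ∑ y, Q x y = 0

/-- A right-continuous, time-homogeneous continuous-time Markov chain `X` on a measurable space `Ω`
with values in the finite (discrete) state space `E`, with a family `(P x)` of probability measures
such that `P x` is the law of the chain started at `x`, and with Markov generator `Q`. -/
structure MarkovChain (Ω : Type*) [MeasurableSpace Ω] {E : Type*} [Fintype E]
    [TopologicalSpace E] [DiscreteTopology E] [MeasurableSpace E] [BorelSpace E]
    (Q : Matrix E E ℝ) where
  /-- The process. -/
  X : ℝ≥0 → Ω → E
  /-- The probability measures. -/
  P : E → Measure Ω
  isProbabilityMeasure : ∀ x, IsProbabilityMeasure (P x)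
  measurable : ∀ t, Measurable (X t)
  rightContinuous : ∀ ω t, ContinuousWithinAt (fun s => X s ω) (Set.Ici t) t
  start : ∀ x, P x {ω | X 0 ω = x} = 1
  /-- Time-homogeneous Markov property with respect to the natural filtration: almost surely,
  `P_x (X_{s+t} = y | F_s) = P_t (X_s, y)`, where `P_t (z, y) = P_z (X_t = y)`. -/
  markov : ∀ x s t y,
    (P x)⟦{ω | X (s + t) ω = y} |
        Filtration.natural X (fun r => (measurable r).stronglyMeasurable) s⟧
      =ᵐ[P x] fun ω => (P (X s ω)).real {ω' | X t ω' = y}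
  isMarkovGenerator : IsMarkovGenerator Q
  /-- `Q` is the right derivative at time `0` of the transition matrices `P_t`. -/
  generator : ∀ x y,
    HasDerivWithinAt (fun t : ℝ => (P x).real {ω | X t.toNNReal ω = y}) (Q x y) (Set.Ici 0) 0

/-- The function `x ↦ Q[f](x) - β f(x)`, where `Q[f](x) = ∑ y, Q x y * f y`. -/
def genSub {E : Type*} [Fintype E] (Q : Matrix E E ℝ) (β : ℝ) (f : E → ℝ) (x : E) : ℝ :=
  (Q *ᵥ f) x - β * f x

/-- The system of verification conditions for a candidate function `W`, with sets `A` and `B`. -/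
structure VerificationConditions {E : Type*} [Fintype E] (Q : Matrix E E ℝ) (β : ℝ)
    (ψ φ : E → ℝ) (W : E → ℝ) (A B : Set E) : Prop where
  on_A : ∀ x ∈ A, genSub Q β W x ≤ 0 ∧ W x = ψ x
  on_B : ∀ x ∈ B, 0 ≤ genSub Q β W x ∧ W x = φ x
  outside : ∀ x, x ∉ A ∪ B ∪ {z | φ z = ψ z} → genSub Q β W x = 0
  between : ∀ x, ψ x ≤ W x ∧ W x ≤ φ x

namespace MarkovChain

variable {Ω : Type*} [MeasurableSpace Ω] {E : Type*} [Fintype E]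
  [TopologicalSpace E] [DiscreteTopology E] [MeasurableSpace E] [BorelSpace E]
  {Q : Matrix E E ℝ} (C : MarkovChain Ω Q) (β : ℝ) (ψ φ : E → ℝ)

/-- The natural filtration of the chain. -/
noncomputable def filtration : Filtration ℝ≥0 ‹MeasurableSpace Ω› :=
  Filtration.natural C.X fun t => (C.measurable t).stronglyMeasurable

/-- The set of all `[0, ∞]`-valued stopping times of the natural filtration. -/
def StoppingTimes : Set (Ω → WithTop ℝ≥0) := {τ | IsStoppingTime C.filtration τ}

/-- The hitting time `h(A) = inf {t ≥ 0 : X_t ∈ A}` (with `inf ∅ = ∞`). -/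
noncomputable def hit (A : Set E) : Ω → WithTop ℝ≥0 := hittingAfter C.X A 0

/-- The discounted stopped variable `e^{-β η} f(X_η)`, equal to `0` on `{η = ∞}`. -/
noncomputable def discounted (f : E → ℝ) (η : Ω → WithTop ℝ≥0) (ω : Ω) : ℝ :=
  if η ω = ⊤ then 0
  else Real.exp (-(β * ((η ω).untopD 0 : ℝ≥0))) * f (C.X ((η ω).untopD 0) ω)

/-- The expected payoff
`R_x(τ, γ) = E_x [e^{-β τ} ψ(X_τ) 1_{τ ≤ γ} + e^{-β γ} φ(X_γ) 1_{τ > γ}]`. -/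
noncomputable def payoff (x : E) (τ γ : Ω → WithTop ℝ≥0) : ℝ :=
  ∫ ω, (if τ ω ≤ γ ω then C.discounted β ψ τ ω else C.discounted β φ γ ω) ∂(C.P x)

/-- The upper value `inf_γ sup_τ R_x(τ, γ)`. -/
noncomputable def upperValue (x : E) : ℝ :=
  ⨅ γ : C.StoppingTimes, ⨆ τ : C.StoppingTimes, C.payoff β ψ φ x τ γ

/-- The lower value `sup_τ inf_γ R_x(τ, γ)`. -/
noncomputable def lowerValue (x : E) : ℝ :=
  ⨆ τ : C.StoppingTimes, ⨅ γ : C.StoppingTimes, C.payoff β ψ φ x τ γ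

/-- `V` is the value function of the game: the lower and the upper value functions both equal `V`. -/
def IsValueFunction (V : E → ℝ) : Prop :=
  ∀ x, C.lowerValue β ψ φ x = V x ∧ C.upperValue β ψ φ x = V x

/-- The one-player value `V₀(x) = sup_τ E_x [e^{-β τ} ψ(X_τ)]`. -/
noncomputable def V₀ (x : E) : ℝ :=
  ⨆ τ : C.StoppingTimes, ∫ ω, C.discounted β ψ τ ω ∂(C.P x)

/-- `x ↦ sup_τ R_x(τ, h(S))`: the best response of the sup-player to the hitting time of `S`. -/
noncomputable def bestResponse (S : Set E) (x : E) : ℝ :=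
  ⨆ τ : C.StoppingTimes, C.payoff β ψ φ x τ (C.hit S)

/-- The inner iteration for a given set `S`, indexed from `0`: `D⁽⁰⁾ = {Q[ψ] - β ψ ≤ 0} ∩ Sᶜ` and
`D⁽ⁿ⁺¹⁾ = {Q[V⁽ⁿ⁾] - β V⁽ⁿ⁾ ≤ 0} ∩ D⁽ⁿ⁾`, where `V⁽ⁿ⁾(x) = R_x(h(D⁽ⁿ⁾), h(S))`. -/
noncomputable def innerD (S : Set E) : ℕ → Set E
  | 0 => {x | genSub Q β ψ x ≤ 0} ∩ Sᶜ
  | n + 1 =>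
    {x | genSub Q β (fun z => C.payoff β ψ φ z (C.hit (innerD S n)) (C.hit S)) x ≤ 0} ∩ innerD S n

/-- The sets `S_k`, indexed from `0`: the first one is `{V₀ > φ} ∪ {φ = ψ}`, and the next one is
`(S_k ∩ {Q[V_k] - β V_k ≥ 0}) ∪ {φ = ψ}`, where `V_k(x) = sup_τ R_x(τ, h(S_k))`. -/
noncomputable def seqS : ℕ → Set E
  | 0 => {x | φ x < C.V₀ β ψ x} ∪ {x | φ x = ψ x}
  | k + 1 =>
    (seqS k ∩ {x | 0 ≤ genSub Q β (C.bestResponse β ψ φ (seqS k)) x}) ∪ {x | φ x = ψ x}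

/-- The sets `D_k = ⋂ n, D_k⁽ⁿ⁾`. -/
noncomputable def seqD (k : ℕ) : Set E := ⋂ n, C.innerD β ψ φ (C.seqS β ψ φ k) n

/-- `D_∞ = ⋃ k, D_k`. -/
noncomputable def limD : Set E := ⋃ k, C.seqD β ψ φ k

/-- `S_∞ = ⋂ k, S_k`. -/
noncomputable def limS : Set E := ⋂ k, C.seqS β ψ φ k

end MarkovChain

end StoppingGame

/-! Call `f` superharmonic where `genSub Q β f ≤ 0`. Since `β > 0`, the maximum principle gives
comparison of functions and solvability of Dirichlet problems. Optional stopping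
(`integral_discounted_le`) transfers this to the game: a function superharmonic until play ends and
above the amount then paid bounds the payoff (`payoff_le`); `le_payoff` is the dual. So the payoff
of two hitting times of disjoint sets solves a Dirichlet problem.

For fixed `S` the inner loop is policy iteration for the sup-player: dropping the states where
stopping is worse than continuing never lowers the payoff. As `E` is finite it stabilizes, and its
limit solves the obstacle problem off `S`, so it is the best response to `hit S`
(`solvesObstacle_bestResponse`).

The outer loop drops from `S` only states where the current best response is strictly superharmonic.
That function is then still a supersolution for the smaller set, so best responses decrease
(`bestResponse_seqS_succ_le`); the choice of the first set puts them below `φ`. Once `S` is stable,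
the best response `W` is also subharmonic on `S` away from `{φ = ψ}`. Hence `hit S` holds the
sup-player to at most `W`, while stopping on the final `D` or on `{φ = ψ}` guarantees at least `W`:
a saddle point. -/

namespace StoppingGame

/-! ### Maximum principle and Dirichlet problem for the killed generator. -/

section Generator

variable {E : Type*} [Fintype E] {Q : Matrix E E ℝ} {β : ℝ}

lemma genSub_sub (f g : E → ℝ) (x : E) :
    genSub Q β (fun z => f z - g z) x = genSub Q β f x - genSub Q β g x := by
  have : (fun z => f z - g z) = f - g := rfl
  simp only [genSub, this, Matrix.mulVec_sub, Pi.sub_apply]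
  ring

lemma genSub_neg (f : E → ℝ) (x : E) :
    genSub Q β (fun z => -f z) x = -genSub Q β f x := by
  have : (fun z => -f z) = -f := rfl
  simp only [genSub, this, Matrix.mulVec_neg, Pi.neg_apply]
  ring

/-- The maximum principle for a killed Markov generator. -/
lemma IsMarkovGenerator.nonneg_of_genSub_nonpos (hQ : IsMarkovGenerator Q) (hβ : 0 < β)
    {F : Set E} {w : E → ℝ} (hF : ∀ x ∈ F, 0 ≤ w x) (hw : ∀ x ∉ F, genSub Q β w x ≤ 0) (x : E) :
    0 ≤ w x := by
  have : Nonempty E := ⟨x⟩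
  obtain ⟨z, hz⟩ := Finite.exists_min w
  by_contra! hx
  have hz0 : w z < 0 := (hz x).trans_lt hx
  have hzF : z ∉ F := fun h => hz0.not_ge (hF z h)
  have hQw : (Q *ᵥ w) z = ∑ y, Q z y * (w y - w z) := by
    simp only [mul_sub, Finset.sum_sub_distrib, ← Finset.sum_mul, hQ.row_sum_zero z, zero_mul,
      sub_zero]
    rfl
  have hnonneg : 0 ≤ (Q *ᵥ w) z := by
    rw [hQw]
    refine Finset.sum_nonneg fun y _ => ?_
    rcases eq_or_ne z y with rfl | hzy
    · simp
    · exact mul_nonneg (hQ.nonneg_offDiag z y hzy) (sub_nonneg.2 (hz y))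
  have := hw z hzF
  unfold genSub at this
  nlinarith [mul_pos hβ (neg_pos.2 hz0)]

/-- Comparison principle: `g ≤ f` on `F` and `Q[f] - β f ≤ Q[g] - β g` off `F` imply `g ≤ f`. -/
lemma IsMarkovGenerator.le_of_genSub_le (hQ : IsMarkovGenerator Q) (hβ : 0 < β)
    {F : Set E} {f g : E → ℝ} (hF : ∀ x ∈ F, g x ≤ f x)
    (h : ∀ x ∉ F, genSub Q β f x ≤ genSub Q β g x) (x : E) : g x ≤ f x :=
  sub_nonneg.1 <| hQ.nonneg_of_genSub_nonpos (w := fun z => f z - g z) hβ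
    (fun x hx => sub_nonneg.2 (hF x hx))
    (fun x hx => by rw [genSub_sub]; exact sub_nonpos.2 (h x hx)) x

/-- Solvability of the Dirichlet problem for a killed Markov generator. -/
lemma IsMarkovGenerator.exists_dirichlet (hQ : IsMarkovGenerator Q) (hβ : 0 < β) (F : Set E)
    (g : E → ℝ) : ∃ u : E → ℝ, (∀ x ∈ F, u x = g x) ∧ ∀ x ∉ F, genSub Q β u x = 0 := by
  classical
  -- Boundary rows on `F`, generator rows elsewhere. The maximum principle for `u` and `-u` makes
  -- the kernel trivial, and in finite dimension injectivity gives surjectivity.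
  let T : (E → ℝ) →ₗ[ℝ] (E → ℝ) :=
    { toFun := fun u x => if x ∈ F then u x else genSub Q β u x
      map_add' := fun u v => by
        ext x
        by_cases hx : x ∈ F
        · simp [hx]
        · simp only [hx, if_false, genSub, Matrix.mulVec_add, Pi.add_apply]; ring
      map_smul' := fun c u => by
        ext x
        by_cases hx : x ∈ F
        · simp [hx]
        · simp only [hx, if_false, genSub, Matrix.mulVec_smul, Pi.smul_apply, smul_eq_mul,
            RingHom.id_apply]
          ring }
  have hT : ∀ u x, T u x = if x ∈ F then u x else genSub Q β u x := fun _ _ => rfl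
  have hnonneg : ∀ u : E → ℝ, T u = 0 → ∀ x, 0 ≤ u x := fun u hu =>
    hQ.nonneg_of_genSub_nonpos (F := F) hβ
      (fun x hx => by have := congrFun hu x; rw [hT, if_pos hx] at this; exact this.ge)
      (fun x hx => by have := congrFun hu x; rw [hT, if_neg hx] at this; exact this.le)
  have hinj : Function.Injective T := by
    refine (injective_iff_map_eq_zero T).2 fun u hu => funext fun x => ?_
    have h1 := hnonneg u hu x
    have h2 := hnonneg (-u) (by rw [map_neg, hu, neg_zero]) x
    exact le_antisymm (neg_nonneg.1 h2) h1
  obtain ⟨u, hu⟩ := LinearMap.injective_iff_surjective.1 hinj (fun x => if x ∈ F then g x else 0)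
  refine ⟨u, fun x hx => ?_, fun x hx => ?_⟩
  · have := congrFun hu x
    rwa [hT, if_pos hx, if_pos hx] at this
  · have := congrFun hu x
    rwa [hT, if_neg hx, if_neg hx] at this

end Generator

/-- A decreasing sequence of subsets of a finite type attains its intersection. -/
lemma exists_forall_ge_eq_iInter {E : Type*} [Finite E] {D : ℕ → Set E} (hD : Antitone D) :
    ∃ n, ∀ m ≥ n, D m = ⋂ i, D i := by
  obtain ⟨n, hn⟩ := WellFoundedLT.antitone_chain_condition (α := Set E) hD
  have hn' : D n = ⋂ i, D i := by
    refine Set.Subset.antisymm (Set.subset_iInter fun i => ?_) (Set.iInter_subset _ _)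
    rcases le_total n i with h | h
    · exact (hn i h).subset
    · exact hD h
  exact ⟨n, fun m hm => (hn m hm).symm.trans hn'⟩

end StoppingGame

namespace StoppingGame

/-! ### The discounted chain and its transition operator. -/

namespace MarkovChain

variable {Ω : Type*} [MeasurableSpace Ω] {E : Type*} [Fintype E]
  [TopologicalSpace E] [DiscreteTopology E] [MeasurableSpace E] [BorelSpace E]
  {Q : Matrix E E ℝ} (C : MarkovChain Ω Q) (β : ℝ) {f : E → ℝ}

/-- The discounted value `e^{-β t} f(X_t)` at a deterministic time. -/
noncomputable def discountedAt (f : E → ℝ) (t : ℝ≥0) (ω : Ω) : ℝ :=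
  Real.exp (-(β * t)) * f (C.X t ω)

lemma measurable_comp (f : E → ℝ) (t : ℝ≥0) : Measurable fun ω => f (C.X t ω) :=
  (measurable_of_countable f).comp (C.measurable t)

lemma measurable_discountedAt (f : E → ℝ) (t : ℝ≥0) : Measurable (C.discountedAt β f t) :=
  (C.measurable_comp f t).const_mul _

variable {β} in
lemma abs_discountedAt_le (f : E → ℝ) (t : ℝ≥0) (ω : Ω) :
    |C.discountedAt β f t ω| ≤ Real.exp (-(β * t)) * ∑ y, |f y| := by
  rw [discountedAt, abs_mul, Real.abs_exp]
  gcongr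
  exact Finset.single_le_sum (f := fun y => |f y|) (fun _ _ => abs_nonneg _) (Finset.mem_univ _)

variable {β} in
lemma exp_neg_mul_nnreal_le_one (hβ : 0 < β) (t : ℝ≥0) : Real.exp (-(β * t)) ≤ 1 :=
  Real.exp_le_one_iff.2 (by have := mul_nonneg hβ.le t.2; simpa using this)

lemma integrable_comp (f : E → ℝ) (t : ℝ≥0) (x : E) :
    Integrable (fun ω => f (C.X t ω)) (C.P x) := by
  have := C.isProbabilityMeasure x
  refine Integrable.of_bound (C.measurable_comp f t).aestronglyMeasurable (∑ y, |f y|)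
    (ae_of_all _ fun ω => ?_)
  exact Finset.single_le_sum (f := fun y => |f y|) (fun _ _ => abs_nonneg _) (Finset.mem_univ _)

lemma integrable_discountedAt (f : E → ℝ) (t : ℝ≥0) (x : E) :
    Integrable (C.discountedAt β f t) (C.P x) :=
  (C.integrable_comp f t x).const_mul _

lemma measurableSet_fiber (t : ℝ≥0) (y : E) : MeasurableSet {ω | C.X t ω = y} :=
  C.measurable t (MeasurableSet.singleton y)

/-- Integration of `f(X_t)` over a set, by summation over the states. -/
lemma setIntegral_comp_eq_sum (f : E → ℝ) (t : ℝ≥0) (x : E) (A : Set Ω) :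
    ∫ ω in A, f (C.X t ω) ∂C.P x
      = ∑ y, (∫ ω in A, {ω | C.X t ω = y}.indicator (fun _ => (1 : ℝ)) ω ∂C.P x) * f y := by
  classical
  have := C.isProbabilityMeasure x
  simp_rw [← integral_mul_const]
  rw [← integral_finsetSum]
  · refine integral_congr_ae (ae_of_all _ fun ω => ?_)
    simp [Set.indicator_apply]
  · intro y _
    exact (((integrable_const (1 : ℝ)).indicator
      (C.measurableSet_fiber t y)).mul_const _).integrableOn

/-- The transition operator `(P_t f)(x) = ∑ y, P_x (X_t = y) f(y)`. -/
noncomputable def transition (t : ℝ≥0) (f : E → ℝ) (x : E) : ℝ :=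
  ∑ y, (C.P x).real {ω | C.X t ω = y} * f y

/-- The Markov property, integrated over an event of the past. -/
lemma setIntegral_markov (f : E → ℝ) (s t : ℝ≥0) (x : E) {A : Set Ω}
    (hA : MeasurableSet[C.filtration s] A) :
    ∫ ω in A, f (C.X (s + t) ω) ∂C.P x = ∫ ω in A, C.transition t f (C.X s ω) ∂C.P x := by
  have := C.isProbabilityMeasure x
  have hA' : MeasurableSet A := C.filtration.le s A hA
  rw [setIntegral_comp_eq_sum]
  unfold transition
  rw [integral_finsetSum]
  · refine Finset.sum_congr rfl fun y _ => ?_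
    rw [integral_mul_const, ← setIntegral_condExp (C.filtration.le s)
      ((integrable_const (1 : ℝ)).indicator (C.measurableSet_fiber (s + t) y)) hA]
    congr 1
    exact integral_congr_ae (ae_restrict_of_ae (C.markov x s t y))
  · intro y _
    exact (C.integrable_comp (fun z => (C.P z).real {ω | C.X t ω = y} * f y) s x).integrableOn

lemma ae_start (x : E) : ∀ᵐ ω ∂C.P x, C.X 0 ω = x := by
  have := C.isProbabilityMeasure x
  have h := (prob_compl_eq_zero_iff (μ := C.P x) (C.measurableSet_fiber 0 x)).2 (C.start x)
  exact h

lemma integral_start (f : E → ℝ) (x : E) : ∫ ω, f (C.X 0 ω) ∂C.P x = f x := by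
  have := C.isProbabilityMeasure x
  rw [integral_congr_ae (g := fun _ => f x) ((C.ae_start x).mono fun ω h => by simp only [h])]
  simp

lemma transition_zero (f : E → ℝ) (x : E) : C.transition 0 f x = f x := by
  have := C.isProbabilityMeasure x
  rw [← C.integral_start f x, ← setIntegral_univ, setIntegral_comp_eq_sum]
  refine Finset.sum_congr rfl fun y _ => ?_
  rw [setIntegral_univ, integral_indicator_const _ (C.measurableSet_fiber 0 y)]
  simp

/-- Over a short time step the discounted transition operator moves `f` by at most
`δ (Q[f] - β f + ε)`. -/
lemma eventually_transition_le (f : E → ℝ) {ε : ℝ} (hε : 0 < ε) :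
    ∀ᶠ δ : ℝ in 𝓝[>] 0, ∀ x,
      Real.exp (-(β * δ)) * C.transition δ.toNNReal f x - f x ≤ δ * (genSub Q β f x + ε) := by
  rw [eventually_all]
  intro x
  have h1 : HasDerivWithinAt (fun δ : ℝ => C.transition δ.toNNReal f x) ((Q *ᵥ f) x)
      (Set.Ici 0) 0 := HasDerivWithinAt.fun_sum fun y _ => (C.generator x y).mul_const (f y)
  have h2 : HasDerivWithinAt (fun δ : ℝ => Real.exp (-(β * δ))) (-β) (Set.Ici 0) 0 := by
    have : HasDerivAt (fun δ : ℝ => Real.exp (-(β * δ))) (Real.exp (-(β * 0)) * -(β * 1)) 0 :=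
      ((hasDerivAt_id (0 : ℝ)).const_mul β).neg.exp
    simpa using this.hasDerivWithinAt
  have h3 := (h2.mul h1).Ioi_of_Ici
  rw [hasDerivWithinAt_iff_tendsto_slope' (by simp)] at h3
  have hval : -β * C.transition (0 : ℝ).toNNReal f x + Real.exp (-(β * 0)) * (Q *ᵥ f) x
      = genSub Q β f x := by
    simp [transition_zero, genSub]; ring
  rw [hval] at h3
  filter_upwards [h3.eventually_lt_const (lt_add_of_pos_right _ hε), self_mem_nhdsWithin]
    with δ hδ hδ0
  rw [slope_def_field, div_lt_iff₀ (by simpa using hδ0)] at hδ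
  simp only [Pi.mul_apply, Real.toNNReal_zero, transition_zero, mul_zero, neg_zero, Real.exp_zero,
    one_mul, sub_zero] at hδ
  linarith

variable {β} in
/-- The expected discounted increment over one time step, on an event of the past on which
`Q[f] - β f ≤ 0` at the present state. -/
lemma setIntegral_increment_le {ε : ℝ} {δ : ℝ≥0}
    (hδ : ∀ x, Real.exp (-(β * δ)) * C.transition δ f x - f x ≤ δ * (genSub Q β f x + ε))
    (hε : 0 ≤ ε) (s : ℝ≥0) (x : E) {A : Set Ω} (hA : MeasurableSet[C.filtration s] A)
    (hneg : ∀ ω ∈ A, genSub Q β f (C.X s ω) ≤ 0) :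
    ∫ ω in A, (C.discountedAt β f (s + δ) ω - C.discountedAt β f s ω) ∂C.P x
      ≤ Real.exp (-(β * s)) * (δ * ε) := by
  have := C.isProbabilityMeasure x
  have hA' : MeasurableSet A := C.filtration.le s A hA
  have e : ∫ ω in A, (C.discountedAt β f (s + δ) ω - C.discountedAt β f s ω) ∂C.P x
      = ∫ ω in A, Real.exp (-(β * s)) *
        (Real.exp (-(β * δ)) * C.transition δ f (C.X s ω) - f (C.X s ω)) ∂C.P x := by
    rw [integral_sub (C.integrable_discountedAt β f _ x).integrableOn
      (C.integrable_discountedAt β f _ x).integrableOn, integral_const_mul, integral_sub,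
      integral_const_mul, ← C.setIntegral_markov f s δ x hA]
    · simp only [discountedAt, integral_const_mul]
      rw [NNReal.coe_add, mul_add, neg_add, Real.exp_add]
      ring
    · exact ((C.integrable_comp (C.transition δ f) s x).const_mul _).integrableOn
    · exact (C.integrable_comp f s x).integrableOn
  rw [e]
  calc _ ≤ ∫ _ in A, Real.exp (-(β * s)) * (δ * ε) ∂C.P x := by
        refine setIntegral_mono_on ?_ (integrable_const _).integrableOn hA' fun ω hω => ?_
        · exact (C.integrable_comp (fun z => Real.exp (-(β * s)) *
            (Real.exp (-(β * δ)) * C.transition δ f z - f z)) s x).integrableOn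
        · gcongr
          refine (hδ _).trans ?_
          gcongr
          linarith [hneg ω hω]
    _ = (C.P x).real A * (Real.exp (-(β * s)) * (δ * ε)) := by simp
    _ ≤ 1 * (Real.exp (-(β * s)) * (δ * ε)) := by
        gcongr
        exact measureReal_le_one
    _ = _ := one_mul _

/-! ### Optional stopping by discretization of time. -/

/-- The discounted value of `f` along the chain, observed on the grid `δ ℕ` and stopped at the
first grid time after `η` (and at time `T δ` at the latest). -/
noncomputable def gridStopped (f : E → ℝ) (δ : ℝ≥0) (η : Ω → WithTop ℝ≥0) (T : ℕ) (ω : Ω) : ℝ :=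
  C.discountedAt β f 0 ω + ∑ n ∈ Finset.range T, {ω | ((n * δ : ℝ≥0) : WithTop ℝ≥0) < η ω}.indicator
    (fun ω => C.discountedAt β f (n * δ + δ) ω - C.discountedAt β f (n * δ) ω) ω

variable {β} {η : Ω → WithTop ℝ≥0}

lemma measurableSet_lt_stoppingTime (hη : IsStoppingTime C.filtration η) (t : ℝ≥0) :
    MeasurableSet[C.filtration t] {ω | (t : WithTop ℝ≥0) < η ω} :=
  hη.measurableSet_gt t

lemma measurable_gridStopped (hη : IsStoppingTime C.filtration η) (f : E → ℝ) (δ : ℝ≥0) (T : ℕ) :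
    Measurable (C.gridStopped β f δ η T) := by
  refine (C.measurable_discountedAt β f 0).add (Finset.measurable_fun_sum _ fun n _ => ?_)
  exact ((C.measurable_discountedAt β f _).sub (C.measurable_discountedAt β f _)).indicator
    (C.filtration.le _ _ (C.measurableSet_lt_stoppingTime hη _))

/-- The error per step is `δ ε`, discounted by `exp (-β n δ)`, so the geometric sum is bounded
uniformly in the horizon `T` and stays bounded as `δ → 0`. -/
lemma integral_gridStopped_le (hβ : 0 < β) (hη : IsStoppingTime C.filtration η)
    (hneg : ∀ ω (s : ℝ≥0), (s : WithTop ℝ≥0) < η ω → genSub Q β f (C.X s ω) ≤ 0)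
    {ε : ℝ} {δ : ℝ≥0} (hδ0 : 0 < δ)
    (hδ : ∀ x, Real.exp (-(β * δ)) * C.transition δ f x - f x ≤ δ * (genSub Q β f x + ε))
    (hε : 0 ≤ ε) (T : ℕ) (x : E) :
    ∫ ω, C.gridStopped β f δ η T ω ∂C.P x ≤ f x + (1 + β * δ) / β * ε := by
  have := C.isProbabilityMeasure x
  have hmeas : ∀ n : ℕ, MeasurableSet {ω | ((n * δ : ℝ≥0) : WithTop ℝ≥0) < η ω} := fun n =>
    C.filtration.le _ _ (C.measurableSet_lt_stoppingTime hη _)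
  have hint : ∀ n : ℕ, Integrable ({ω | ((n * δ : ℝ≥0) : WithTop ℝ≥0) < η ω}.indicator
      fun ω => C.discountedAt β f (n * δ + δ) ω - C.discountedAt β f (n * δ) ω) (C.P x) := fun n =>
    ((C.integrable_discountedAt β f _ x).sub (C.integrable_discountedAt β f _ x)).indicator (hmeas n)
  unfold gridStopped
  rw [integral_add (C.integrable_discountedAt β f 0 x) (integrable_finsetSum _ fun n _ => hint n),
    integral_finsetSum _ fun n _ => hint n]
  have h0 : ∫ ω, C.discountedAt β f 0 ω ∂C.P x = f x := by
    simp [discountedAt, C.integral_start]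
  rw [h0]
  gcongr
  set r := Real.exp (-(β * δ)) with hr
  have hr1 : r < 1 :=
    Real.exp_lt_one_iff.2 (by have := mul_pos hβ (NNReal.coe_pos.2 hδ0); linarith)
  have hr0 : 0 ≤ r := (Real.exp_pos _).le
  calc _ ≤ ∑ n ∈ Finset.range T, r ^ n * (δ * ε) := by
        refine Finset.sum_le_sum fun n _ => ?_
        rw [integral_indicator (hmeas n)]
        refine (C.setIntegral_increment_le hδ hε (n * δ) x (C.measurableSet_lt_stoppingTime hη _)
          fun ω hω => hneg ω _ hω).trans_eq ?_
        rw [hr, ← Real.exp_nat_mul]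
        congr 2
        push_cast
        ring
    _ = (∑ n ∈ Finset.range T, r ^ n) * (δ * ε) := by rw [Finset.sum_mul]
    _ ≤ (1 - r)⁻¹ * (δ * ε) := by
        gcongr
        rw [← tsum_geometric_of_lt_one hr0 hr1]
        exact (summable_geometric_of_lt_one hr0 hr1).sum_le_tsum _ fun _ _ => by positivity
    -- From `1 + βδ ≤ exp (βδ)` one gets `1 - r ≥ βδ / (1 + βδ)`.
    _ ≤ (1 + β * δ) / (β * δ) * (δ * ε) := by
        gcongr
        rw [inv_le_comm₀ (by linarith) (by positivity), inv_div]
        have : r ≤ 1 / (1 + β * δ) := by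
          rw [hr, Real.exp_neg, ← one_div]
          gcongr
          linarith [Real.add_one_le_exp (β * (δ : ℝ))]
        have h' : β * δ / (1 + β * δ) = 1 - 1 / (1 + β * δ) := by field_simp; ring
        linarith
    _ = (1 + β * δ) / β * ε := by field_simp

/-- Telescoping: the grid-stopped value is the discounted value at a single grid time. -/
lemma gridStopped_eq (f : E → ℝ) (δ : ℝ≥0) (N T : ℕ) (ω : Ω)
    (hN : ∀ n < T, ((n * δ : ℝ≥0) : WithTop ℝ≥0) < η ω ↔ n < N) :
    C.gridStopped β f δ η T ω = C.discountedAt β f ((min N T : ℕ) * δ) ω := by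
  induction T with
  | zero => simp [gridStopped]
  | succ T ih =>
    have ih := ih fun n hn => hN n (hn.trans T.lt_succ_self)
    unfold gridStopped at ih ⊢
    rw [Finset.sum_range_succ, ← add_assoc, ih, Set.indicator_apply]
    simp only [Set.mem_ofPred_eq, hN T T.lt_succ_self]
    split_ifs with h
    · rw [min_eq_right h.le, min_eq_right (Nat.succ_le_of_lt h)]
      push_cast
      rw [add_mul, one_mul]
      ring
    · rw [min_eq_left (not_lt.1 h), min_eq_left ((not_lt.1 h).trans T.le_succ), add_zero]

lemma abs_gridStopped_le (hβ : 0 < β) (f : E → ℝ) {δ : ℝ≥0} (hδ0 : 0 < δ) (T : ℕ) (ω : Ω) :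
    |C.gridStopped β f δ η T ω| ≤ ∑ y, |f y| := by
  have key : ∃ N : ℕ, ∀ n < T, ((n * δ : ℝ≥0) : WithTop ℝ≥0) < η ω ↔ n < N := by
    cases h : η ω with
    | top => exact ⟨T, fun n hn => iff_of_true (WithTop.coe_lt_top _) hn⟩
    | coe t =>
      refine ⟨⌈t / δ⌉₊, fun n _ => ?_⟩
      rw [Nat.lt_ceil, lt_div_iff₀ hδ0, WithTop.coe_lt_coe]
  obtain ⟨N, hN⟩ := key
  rw [C.gridStopped_eq f δ N T ω hN]
  refine (C.abs_discountedAt_le f _ ω).trans ?_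
  exact mul_le_of_le_one_left (Finset.sum_nonneg fun _ _ => abs_nonneg _)
    (exp_neg_mul_nnreal_le_one hβ _)

/-- As the mesh tends to zero, the grid-stopped values tend to the stopped value, by right
continuity. -/
lemma tendsto_gridStopped (hβ : 0 < β) (f : E → ℝ) (η : Ω → WithTop ℝ≥0) (ω : Ω) :
    Tendsto (fun m : ℕ => C.gridStopped β f ((m : ℝ≥0) + 1)⁻¹ η ((m + 1) ^ 2) ω) atTop
      (𝓝 (C.discounted β f η ω)) := by
  have hpos : ∀ m : ℕ, 0 < ((m : ℝ≥0) + 1)⁻¹ := fun m => by positivity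
  -- Mesh `1/(m+1)` with `(m+1)^2` steps has horizon `m+1`: on `{η = ∞}` discounting kills the
  -- limit, and a finite `η` is eventually inside the horizon.
  cases h : η ω with
  | top =>
    have e : ∀ m : ℕ, C.gridStopped β f ((m : ℝ≥0) + 1)⁻¹ η ((m + 1) ^ 2) ω
        = C.discountedAt β f ((m : ℝ≥0) + 1) ω := fun m => by
      rw [C.gridStopped_eq f _ ((m + 1) ^ 2) _ ω fun n hn => by
        rw [h]; exact iff_of_true (WithTop.coe_lt_top _) hn, min_self]
      congr 1
      push_cast
      field_simp
    simp only [e, discounted, h, if_true]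
    refine squeeze_zero_norm (fun m => C.abs_discountedAt_le f _ ω) ?_
    rw [← zero_mul (∑ y, |f y|)]
    refine Tendsto.mul_const _ (Real.tendsto_exp_neg_atTop_nhds_zero.comp ?_)
    refine Tendsto.const_mul_atTop hβ ?_
    push_cast
    exact tendsto_atTop_add_const_right _ _ tendsto_natCast_atTop_atTop
  | coe t =>
    have hval : C.discounted β f η ω = C.discountedAt β f t ω := by
      rw [discounted, h, if_neg WithTop.coe_ne_top]
      rfl
    rw [hval]
    set u : ℕ → ℝ≥0 := fun m => (⌈t / ((m : ℝ≥0) + 1)⁻¹⌉₊ : ℝ≥0) * ((m : ℝ≥0) + 1)⁻¹ with hu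
    have hu1 : ∀ m, t ≤ u m := fun m => by
      rw [hu]; dsimp only
      rw [← div_le_iff₀ (hpos m)]
      exact Nat.le_ceil _
    have hu2 : ∀ m, u m ≤ t + ((m : ℝ≥0) + 1)⁻¹ := fun m => by
      rw [hu]; dsimp only
      calc _ ≤ (t / ((m : ℝ≥0) + 1)⁻¹ + 1) * ((m : ℝ≥0) + 1)⁻¹ := by
            gcongr; exact (Nat.ceil_lt_add_one (by positivity)).le
        _ = _ := by field_simp
    have hut : Tendsto u atTop (𝓝 t) := by
      refine tendsto_of_tendsto_of_tendsto_of_le_of_le tendsto_const_nhds ?_ hu1 hu2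
      have : Tendsto (fun m : ℕ => ((m : ℝ≥0) + 1)⁻¹) atTop (𝓝 0) := by
        simpa only [one_div] using tendsto_one_div_add_atTop_nhds_zero_nat (𝕜 := ℝ≥0)
      simpa using this.const_add t
    -- The grid times approach `t` from the right and `E` is discrete, so the state is eventually
    -- equal to `X_t`, not merely close.
    have hX : ∀ᶠ m in atTop, C.X (u m) ω = C.X t ω := by
      have := (C.rightContinuous ω t).tendsto.comp
        (tendsto_nhdsWithin_iff.2 ⟨hut, Eventually.of_forall hu1⟩)
      rw [nhds_discrete] at this
      exact tendsto_pure.1 this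
    have hT : ∀ᶠ m : ℕ in atTop, ⌈t / ((m : ℝ≥0) + 1)⁻¹⌉₊ ≤ (m + 1) ^ 2 := by
      obtain ⟨k, hk⟩ := exists_nat_ge t
      filter_upwards [eventually_ge_atTop k] with m hm
      rw [Nat.ceil_le]
      push_cast
      rw [div_inv_eq_mul, pow_two]
      gcongr
      calc t ≤ k := hk
        _ ≤ m := by exact_mod_cast hm
        _ ≤ m + 1 := le_self_add
    have hlim : Tendsto (fun m => Real.exp (-(β * u m)) * f (C.X t ω)) atTop
        (𝓝 (C.discountedAt β f t ω)) := by
      refine Tendsto.mul_const _ ((Real.continuous_exp.tendsto _).comp ?_)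
      exact ((NNReal.tendsto_coe.2 hut).const_mul β).neg
    refine hlim.congr' ?_
    filter_upwards [hX, hT] with m hm hm'
    rw [C.gridStopped_eq f _ ⌈t / ((m : ℝ≥0) + 1)⁻¹⌉₊ _ ω fun n _ => by
      rw [h, Nat.lt_ceil, lt_div_iff₀ (hpos m), WithTop.coe_lt_coe], min_eq_left hm']
    rw [discountedAt, show (⌈t / ((m : ℝ≥0) + 1)⁻¹⌉₊ : ℝ≥0) * ((m : ℝ≥0) + 1)⁻¹ = u m from rfl, hm]

lemma measurable_discounted (hβ : 0 < β) (hη : IsStoppingTime C.filtration η) (f : E → ℝ) :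
    Measurable (C.discounted β f η) :=
  measurable_of_tendsto_metrizable (fun _ => C.measurable_gridStopped hη f _ _)
    (tendsto_pi_nhds.2 fun ω => C.tendsto_gridStopped hβ f η ω)

lemma abs_discounted_le (hβ : 0 < β) (f : E → ℝ) (η : Ω → WithTop ℝ≥0) (ω : Ω) :
    |C.discounted β f η ω| ≤ ∑ y, |f y| :=
  le_of_tendsto (C.tendsto_gridStopped hβ f η ω).abs
    (Eventually.of_forall fun m => C.abs_gridStopped_le hβ f (by positivity) _ ω)

lemma integrable_discounted (hβ : 0 < β) (hη : IsStoppingTime C.filtration η) (f : E → ℝ) (x : E) :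
    Integrable (C.discounted β f η) (C.P x) := by
  have := C.isProbabilityMeasure x
  exact Integrable.of_bound (C.measurable_discounted hβ hη f).aestronglyMeasurable (∑ y, |f y|)
    (ae_of_all _ fun ω => C.abs_discounted_le hβ f η ω)

/-- Optional stopping: if `Q[f] - β f ≤ 0` along the chain before `η`, then
`E_x [e^{-β η} f(X_η)] ≤ f(x)`. -/
theorem integral_discounted_le (hβ : 0 < β) (hη : IsStoppingTime C.filtration η)
    (hneg : ∀ ω (s : ℝ≥0), (s : WithTop ℝ≥0) < η ω → genSub Q β f (C.X s ω) ≤ 0) (x : E) :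
    ∫ ω, C.discounted β f η ω ∂C.P x ≤ f x := by
  have := C.isProbabilityMeasure x
  have hlim : Tendsto
      (fun m : ℕ => ∫ ω, C.gridStopped β f ((m : ℝ≥0) + 1)⁻¹ η ((m + 1) ^ 2) ω ∂C.P x) atTop
      (𝓝 (∫ ω, C.discounted β f η ω ∂C.P x)) :=
    tendsto_integral_of_dominated_convergence (fun _ => ∑ y, |f y|)
      (fun _ => (C.measurable_gridStopped hη f _ _).aestronglyMeasurable) (integrable_const _)
      (fun _ => ae_of_all _ fun ω => C.abs_gridStopped_le hβ f (by positivity) _ ω)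
      (ae_of_all _ fun ω => C.tendsto_gridStopped hβ f η ω)
  have hmesh : Tendsto (fun m : ℕ => ((m : ℝ) + 1)⁻¹) atTop (𝓝[>] 0) := by
    refine tendsto_nhdsWithin_iff.2 ⟨?_, Eventually.of_forall fun _ => ?_⟩
    · simpa only [one_div] using tendsto_one_div_add_atTop_nhds_zero_nat (𝕜 := ℝ)
    · exact Set.mem_Ioi.2 (by positivity)
  have hbound : ∀ ε > 0, ∫ ω, C.discounted β f η ω ∂C.P x ≤ f x + (1 + β) / β * ε := by
    intro ε hε
    refine le_of_tendsto hlim ?_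
    filter_upwards [hmesh.eventually (C.eventually_transition_le β f hε)] with m hm
    have hco : ((m : ℝ) + 1)⁻¹ = ((((m : ℝ≥0) + 1)⁻¹ : ℝ≥0) : ℝ) := by push_cast; rfl
    rw [hco, Real.toNNReal_coe] at hm
    refine (C.integral_gridStopped_le hβ hη hneg (by positivity) hm hε.le _ x).trans ?_
    gcongr
    refine mul_le_of_le_one_right hβ.le ?_
    rw [← hco]
    exact inv_le_one_of_one_le₀ (by have := Nat.cast_nonneg (α := ℝ) m; linarith)
  refine le_of_forall_pos_le_add fun ε hε => ?_
  have := hbound (ε * (β / (1 + β))) (by positivity)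
  have e : (1 + β) / β * (ε * (β / (1 + β))) = ε := by field_simp
  rwa [e] at this

/-! ### Hitting times -/

/-- The infimum is attained: a path outside `A` at time `t` stays outside on some `[t, u)`. -/
lemma hit_mem {A : Set E} {ω : Ω} {t : ℝ≥0} (h : C.hit A ω = t) : C.X t ω ∈ A := by
  by_contra hA
  have hev : ∀ᶠ s in 𝓝[≥] t, C.X s ω ∉ A := by
    have := (C.rightContinuous ω t).tendsto
    rw [nhds_discrete] at this
    filter_upwards [tendsto_pure.1 this] with s hs
    rwa [hs]
  obtain ⟨u, htu, hu⟩ := mem_nhdsGE_iff_exists_Ico_subset.1 hev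
  have hlt : C.hit A ω < u := by rw [h]; exact WithTop.coe_lt_coe.2 htu
  obtain ⟨j, hj, hjA⟩ := hittingAfter_lt_iff.1 hlt
  refine hu ⟨?_, hj.2⟩ hjA
  have := hittingAfter_le_of_mem (u := C.X) (n := 0) hj.1 hjA
  rw [← WithTop.coe_le_coe, ← h]
  exact this

lemma notMem_of_lt_hit {A : Set E} {ω : Ω} {s : ℝ≥0} (h : (s : WithTop ℝ≥0) < C.hit A ω) :
    C.X s ω ∉ A :=
  notMem_of_lt_hittingAfter h zero_le

lemma measurableSet_filtration_fiber {s t : ℝ≥0} (hst : s ≤ t) (A : Set E) :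
    MeasurableSet[C.filtration t] {ω | C.X s ω ∈ A} := by
  refine C.filtration.mono hst _ ?_
  have h : MeasurableSpace.comap (C.X s) inferInstance ≤ C.filtration s :=
    le_iSup₂_of_le s le_rfl le_rfl
  exact h _ ⟨A, A.to_countable.measurableSet, rfl⟩

/-- A visit to `A` strictly before `t` lasts for an interval, so a countable dense set of times
detects it. Time `t` is tested separately, so no right-continuity of the filtration is needed. -/
theorem isStoppingTime_hit (A : Set E) : IsStoppingTime C.filtration (C.hit A) := by
  intro t
  obtain ⟨D, hDc, hDd⟩ := TopologicalSpace.exists_countable_dense ℝ≥0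
  have key : {ω | C.hit A ω ≤ t}
      = {ω | C.X t ω ∈ A} ∪ ⋃ s ∈ D ∩ Set.Iic t, {ω | C.X s ω ∈ A} := by
    ext ω
    simp only [Set.mem_ofPred_eq, Set.mem_union, Set.mem_iUnion, exists_prop]
    constructor
    · intro h
      by_cases htA : C.X t ω ∈ A
      · exact Or.inl htA
      refine Or.inr ?_
      obtain ⟨s, hs⟩ : ∃ s : ℝ≥0, C.hit A ω = s :=
        ⟨_, (WithTop.coe_untop _ (ne_top_of_le_ne_top WithTop.coe_ne_top h)).symm⟩
      have hsA := C.hit_mem hs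
      have hst : s < t := by
        rw [hs, WithTop.coe_le_coe] at h
        exact h.lt_of_ne fun e => htA (e ▸ hsA)
      have hev : ∀ᶠ r in 𝓝[≥] s, C.X r ω = C.X s ω := by
        have := (C.rightContinuous ω s).tendsto
        rw [nhds_discrete] at this
        exact tendsto_pure.1 this
      obtain ⟨u, hsu, hu⟩ := mem_nhdsGE_iff_exists_Ico_subset.1 hev
      obtain ⟨d, hdD, hd⟩ := hDd.exists_between (lt_min hst hsu)
      refine ⟨d, ⟨hdD, (hd.2.trans_le (min_le_left _ _)).le⟩, ?_⟩
      have : C.X d ω = C.X s ω := hu ⟨hd.1.le, hd.2.trans_le (min_le_right _ _)⟩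
      rwa [this]
    · rintro (h | ⟨s, hs, h⟩)
      · exact hittingAfter_le_of_mem zero_le h
      · exact (hittingAfter_le_of_mem zero_le h).trans (WithTop.coe_le_coe.2 hs.2)
  rw [key]
  refine (C.measurableSet_filtration_fiber le_rfl A).union ?_
  exact MeasurableSet.biUnion (hDc.mono Set.inter_subset_left) fun s hs =>
    C.measurableSet_filtration_fiber hs.2 A

end MarkovChain

end StoppingGame

namespace StoppingGame

/-! ### Verification bounds for the payoff. -/

namespace MarkovChain

variable {Ω : Type*} [MeasurableSpace Ω] {E : Type*} [Fintype E]
  [TopologicalSpace E] [DiscreteTopology E] [MeasurableSpace E] [BorelSpace E]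
  {Q : Matrix E E ℝ} (C : MarkovChain Ω Q) {β : ℝ} {ψ φ : E → ℝ} {τ γ : Ω → WithTop ℝ≥0}

lemma discounted_congr_time {η : Ω → WithTop ℝ≥0} {ω : Ω} (h : τ ω = η ω) (f : E → ℝ) :
    C.discounted β f τ ω = C.discounted β f η ω := by
  simp only [discounted, h]

lemma discounted_mono {f g : E → ℝ} {ω : Ω}
    (h : ∀ t : ℝ≥0, τ ω = t → f (C.X t ω) ≤ g (C.X t ω)) :
    C.discounted β f τ ω ≤ C.discounted β g τ ω := by
  unfold discounted
  split_ifs with htop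
  · rfl
  · gcongr
    refine h _ ?_
    rw [← WithTop.coe_untop _ htop]
    rfl

lemma discounted_neg (f : E → ℝ) (η : Ω → WithTop ℝ≥0) (ω : Ω) :
    C.discounted β (fun x => -f x) η ω = -C.discounted β f η ω := by
  unfold discounted
  split_ifs <;> simp

lemma integrable_payoff (hβ : 0 < β) (hτ : IsStoppingTime C.filtration τ)
    (hγ : IsStoppingTime C.filtration γ) (x : E) :
    Integrable (fun ω => if τ ω ≤ γ ω then C.discounted β ψ τ ω else C.discounted β φ γ ω)
      (C.P x) := by
  classical
  have hle : MeasurableSet {ω | τ ω ≤ γ ω} :=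
    hτ.measurableSpace_le _ (hτ.measurableSet_le_stopping_time hγ)
  have := Integrable.piecewise hle (C.integrable_discounted hβ hτ ψ x).integrableOn
    (C.integrable_discounted hβ hγ φ x).integrableOn
  refine this.congr (ae_of_all _ fun ω => ?_)
  by_cases h : τ ω ≤ γ ω <;> simp [Set.piecewise, h]

lemma abs_payoff_le (hβ : 0 < β) (x : E) :
    |C.payoff β ψ φ x τ γ| ≤ ∑ y, |ψ y| + ∑ y, |φ y| := by
  have := C.isProbabilityMeasure x
  have hψ : 0 ≤ ∑ y, |ψ y| := Finset.sum_nonneg fun _ _ => abs_nonneg _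
  have hφ : 0 ≤ ∑ y, |φ y| := Finset.sum_nonneg fun _ _ => abs_nonneg _
  suffices h : ∀ ω, ‖if τ ω ≤ γ ω then C.discounted β ψ τ ω else C.discounted β φ γ ω‖
      ≤ ∑ y, |ψ y| + ∑ y, |φ y| by
    have := norm_integral_le_of_norm_le_const (μ := C.P x) (ae_of_all _ h)
    rwa [probReal_univ, mul_one] at this
  intro ω
  split_ifs
  · exact (C.abs_discounted_le hβ ψ τ ω).trans (le_add_of_nonneg_right hφ)
  · exact (C.abs_discounted_le hβ φ γ ω).trans (le_add_of_nonneg_left hψ)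

/-- Verification of an upper bound of the payoff by a function that is superharmonic before both
players have stopped. -/
lemma payoff_le (hβ : 0 < β) (hτ : IsStoppingTime C.filtration τ)
    (hγ : IsStoppingTime C.filtration γ) {f : E → ℝ}
    (hf : ∀ ω (s : ℝ≥0), (s : WithTop ℝ≥0) < τ ω → (s : WithTop ℝ≥0) < γ ω →
      genSub Q β f (C.X s ω) ≤ 0)
    (hψ : ∀ ω (t : ℝ≥0), τ ω = t → (t : WithTop ℝ≥0) ≤ γ ω → ψ (C.X t ω) ≤ f (C.X t ω))
    (hφ : ∀ ω (t : ℝ≥0), γ ω = t → (t : WithTop ℝ≥0) < τ ω → φ (C.X t ω) ≤ f (C.X t ω)) (x : E) :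
    C.payoff β ψ φ x τ γ ≤ f x := by
  have hmin := hτ.min hγ
  refine (integral_mono (C.integrable_payoff hβ hτ hγ x) (C.integrable_discounted hβ hmin f x)
    fun ω => ?_).trans (C.integral_discounted_le hβ hmin
      (fun ω s hs => hf ω s (lt_min_iff.1 hs).1 (lt_min_iff.1 hs).2) x)
  dsimp only
  split_ifs with h
  · rw [← C.discounted_congr_time (τ := τ) (η := fun ω => min (τ ω) (γ ω)) (min_eq_left h).symm]
    exact C.discounted_mono fun t ht => hψ ω t ht (ht ▸ h)
  · rw [← C.discounted_congr_time (τ := γ) (η := fun ω => min (τ ω) (γ ω))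
      (min_eq_right (not_le.1 h).le).symm]
    exact C.discounted_mono fun t ht => hφ ω t ht (ht ▸ not_le.1 h)

/-- The tie-breaking rule does not involve the rewards and `payoff_le` does not require `ψ ≤ φ`, so
a sign change turns upper bounds into lower ones. -/
lemma payoff_neg (x : E) :
    C.payoff β (fun z => -ψ z) (fun z => -φ z) x τ γ = -C.payoff β ψ φ x τ γ := by
  unfold payoff
  rw [← integral_neg]
  congr 1
  ext ω
  split_ifs <;> exact C.discounted_neg _ _ ω

/-- Verification of a lower bound of the payoff by a function that is subharmonic before both
players have stopped. -/
lemma le_payoff (hβ : 0 < β) (hτ : IsStoppingTime C.filtration τ)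
    (hγ : IsStoppingTime C.filtration γ) {f : E → ℝ}
    (hf : ∀ ω (s : ℝ≥0), (s : WithTop ℝ≥0) < τ ω → (s : WithTop ℝ≥0) < γ ω →
      0 ≤ genSub Q β f (C.X s ω))
    (hψ : ∀ ω (t : ℝ≥0), τ ω = t → (t : WithTop ℝ≥0) ≤ γ ω → f (C.X t ω) ≤ ψ (C.X t ω))
    (hφ : ∀ ω (t : ℝ≥0), γ ω = t → (t : WithTop ℝ≥0) < τ ω → f (C.X t ω) ≤ φ (C.X t ω)) (x : E) :
    f x ≤ C.payoff β ψ φ x τ γ := by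
  have := C.payoff_le (ψ := fun z => -ψ z) (φ := fun z => -φ z) (f := fun z => -f z) hβ hτ hγ
    (fun ω s h1 h2 => by rw [genSub_neg]; exact neg_nonpos.2 (hf ω s h1 h2))
    (fun ω t h1 h2 => neg_le_neg (hψ ω t h1 h2)) (fun ω t h1 h2 => neg_le_neg (hφ ω t h1 h2)) x
  rw [payoff_neg] at this
  exact neg_le_neg_iff.1 this

/-- The payoff for two hitting times solves the Dirichlet problem. -/
lemma payoff_hit_eq (hβ : 0 < β) {D S : Set E} {u : E → ℝ}
    (hD : ∀ x ∈ D, u x = ψ x) (hS : ∀ x ∈ S, u x = φ x)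
    (hu : ∀ x ∉ D ∪ S, genSub Q β u x = 0) (x : E) :
    C.payoff β ψ φ x (C.hit D) (C.hit S) = u x := by
  have h0 : ∀ ω (s : ℝ≥0), (s : WithTop ℝ≥0) < C.hit D ω → (s : WithTop ℝ≥0) < C.hit S ω →
      genSub Q β u (C.X s ω) = 0 := fun ω s h1 h2 =>
    hu _ fun h => h.elim (C.notMem_of_lt_hit h1) (C.notMem_of_lt_hit h2)
  have h1 : ∀ ω (t : ℝ≥0), C.hit D ω = t → (t : WithTop ℝ≥0) ≤ C.hit S ω →
      u (C.X t ω) = ψ (C.X t ω) := fun ω t h _ => hD _ (C.hit_mem h)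
  have h2 : ∀ ω (t : ℝ≥0), C.hit S ω = t → (t : WithTop ℝ≥0) < C.hit D ω →
      u (C.X t ω) = φ (C.X t ω) := fun ω t h _ => hS _ (C.hit_mem h)
  exact le_antisymm
    (C.payoff_le hβ (C.isStoppingTime_hit D) (C.isStoppingTime_hit S)
      (fun ω s a b => (h0 ω s a b).le) (fun ω t a b => (h1 ω t a b).ge)
      (fun ω t a b => (h2 ω t a b).ge) x)
    (C.le_payoff hβ (C.isStoppingTime_hit D) (C.isStoppingTime_hit S)
      (fun ω s a b => (h0 ω s a b).ge) (fun ω t a b => (h1 ω t a b).le)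
      (fun ω t a b => (h2 ω t a b).le) x)

lemma exists_payoff_hit_eq (hβ : 0 < β) {D S : Set E} (hDS : Disjoint D S) :
    ∃ u : E → ℝ, (∀ x, C.payoff β ψ φ x (C.hit D) (C.hit S) = u x) ∧ (∀ x ∈ D, u x = ψ x) ∧
      (∀ x ∈ S, u x = φ x) ∧ ∀ x ∉ D ∪ S, genSub Q β u x = 0 := by
  classical
  obtain ⟨u, hu, hu0⟩ := C.isMarkovGenerator.exists_dirichlet hβ (D ∪ S)
    (fun x => if x ∈ D then ψ x else φ x)
  have hD : ∀ x ∈ D, u x = ψ x := fun x hx => by rw [hu x (Or.inl hx), if_pos hx]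
  have hS : ∀ x ∈ S, u x = φ x := fun x hx => by
    rw [hu x (Or.inr hx), if_neg (hDS.notMem_of_mem_right hx)]
  exact ⟨u, C.payoff_hit_eq hβ hD hS hu0, hD, hS, hu0⟩

end MarkovChain

/-! ### Obstacle problem and policy iteration. -/

/-- `W` solves the obstacle problem with lower obstacle `ψ` off `S`, with the boundary values `φ` on
`S`, and `D` is a set of stopping states for it. -/
structure SolvesObstacle {E : Type*} [Fintype E] (Q : Matrix E E ℝ) (β : ℝ) (ψ φ : E → ℝ)
    (S D : Set E) (W : E → ℝ) : Prop where
  disjoint : Disjoint D S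
  eq_upper : ∀ x ∈ S, W x = φ x
  eq_lower : ∀ x ∈ D, W x = ψ x
  lower_le : ∀ x, ψ x ≤ W x
  superharmonic : ∀ x ∉ S, genSub Q β W x ≤ 0
  harmonic : ∀ x ∉ D ∪ S, genSub Q β W x = 0

/-- The solution of an obstacle problem is the least superharmonic majorant of the obstacle. -/
lemma SolvesObstacle.le {E : Type*} [Fintype E] {Q : Matrix E E ℝ} {β : ℝ} {ψ φ : E → ℝ}
    {S D : Set E} {W f : E → ℝ} (h : SolvesObstacle Q β ψ φ S D W) (hQ : IsMarkovGenerator Q)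
    (hβ : 0 < β) (hS : ∀ x ∈ S, φ x ≤ f x) (hψ : ∀ x, ψ x ≤ f x)
    (hf : ∀ x ∉ S, genSub Q β f x ≤ 0) (x : E) : W x ≤ f x := by
  refine hQ.le_of_genSub_le (F := D ∪ S) hβ ?_ (fun z hz => ?_) x
  · rintro z (hz | hz)
    · rw [h.eq_lower z hz]; exact hψ z
    · rw [h.eq_upper z hz]; exact hS z hz
  · rw [h.harmonic z hz]; exact hf z fun hzS => hz (Or.inr hzS)

namespace MarkovChain

variable {Ω : Type*} [MeasurableSpace Ω] {E : Type*} [Fintype E]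
  [TopologicalSpace E] [DiscreteTopology E] [MeasurableSpace E] [BorelSpace E]
  {Q : Matrix E E ℝ} (C : MarkovChain Ω Q) {β : ℝ} {ψ φ : E → ℝ}

instance : Nonempty C.StoppingTimes := ⟨⟨_, isStoppingTime_const C.filtration 0⟩⟩

lemma bddAbove_payoff (hβ : 0 < β) (x : E) (γ : Ω → WithTop ℝ≥0) :
    BddAbove (Set.range fun τ : C.StoppingTimes => C.payoff β ψ φ x τ γ) :=
  ⟨_, by rintro _ ⟨τ, rfl⟩; exact (abs_le.1 (C.abs_payoff_le hβ x)).2⟩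

lemma bddBelow_payoff (hβ : 0 < β) (x : E) (τ : Ω → WithTop ℝ≥0) :
    BddBelow (Set.range fun γ : C.StoppingTimes => C.payoff β ψ φ x τ γ) :=
  ⟨_, by rintro _ ⟨γ, rfl⟩; exact (abs_le.1 (C.abs_payoff_le hβ x)).1⟩

lemma antitone_innerD (S : Set E) : Antitone (C.innerD β ψ φ S) :=
  antitone_nat_of_succ_le fun _ => Set.inter_subset_right

lemma disjoint_innerD (S : Set E) (n : ℕ) : Disjoint (C.innerD β ψ φ S n) S :=
  Set.disjoint_of_subset_left (C.antitone_innerD S (Nat.zero_le n))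
    (Set.disjoint_left.2 fun _ hx => hx.2)

/-- Policy improvement does not decrease the payoff, so every policy majorizes the obstacle. -/
lemma le_payoff_innerD (hβ : 0 < β) (hψφ : ∀ x, ψ x ≤ φ x) (S : Set E) (n : ℕ) (x : E) :
    ψ x ≤ C.payoff β ψ φ x (C.hit (C.innerD β ψ φ S n)) (C.hit S) := by
  induction n generalizing x with
  | zero =>
    obtain ⟨u, hu, huD, huS, hu0⟩ :=
      C.exists_payoff_hit_eq (ψ := ψ) (φ := φ) hβ (C.disjoint_innerD (β := β) (ψ := ψ) (φ := φ) S 0)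
    rw [hu]
    refine C.isMarkovGenerator.le_of_genSub_le (F := C.innerD β ψ φ S 0 ∪ S) hβ ?_ ?_ x
    · rintro z (hz | hz)
      · exact (huD z hz).ge
      · rw [huS z hz]; exact hψφ z
    · intro z hz
      rw [hu0 z hz]
      by_contra! hneg
      exact hz (Or.inl ⟨hneg.le, fun hzS => hz (Or.inr hzS)⟩)
  | succ n ih =>
    refine (ih x).trans ?_
    obtain ⟨u, hu, huD, huS, hu0⟩ :=
      C.exists_payoff_hit_eq (ψ := ψ) (φ := φ) hβ (C.disjoint_innerD (β := β) (ψ := ψ) (φ := φ) S n)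
    obtain ⟨v, hv, hvD, hvS, hv0⟩ := C.exists_payoff_hit_eq (ψ := ψ) (φ := φ) hβ
      (C.disjoint_innerD (β := β) (ψ := ψ) (φ := φ) S (n + 1))
    have hsucc : C.innerD β ψ φ S (n + 1) = {x | genSub Q β u x ≤ 0} ∩ C.innerD β ψ φ S n := by
      rw [innerD, funext hu]
    rw [hu, hv]
    refine C.isMarkovGenerator.le_of_genSub_le (F := C.innerD β ψ φ S (n + 1) ∪ S) hβ ?_ ?_ x
    · rintro z (hz | hz)
      · rw [hvD z hz, huD z (C.antitone_innerD S n.le_succ hz)]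
      · rw [hvS z hz, huS z hz]
    · intro z hz
      rw [hv0 z hz]
      -- A state just dropped has `genSub` of the old payoff positive, against zero for the new one;
      -- at the other states both are harmonic.
      by_cases hzn : z ∈ C.innerD β ψ φ S n
      · by_contra! hneg
        exact hz (Or.inl (hsucc ▸ ⟨hneg.le, hzn⟩))
      · exact (hu0 z fun h => h.elim hzn fun hzS => hz (Or.inr hzS)).ge

/-- The limit of the inner iteration solves the obstacle problem off `S`, and its solution is the
best response to the hitting time of `S`. -/
theorem solvesObstacle_bestResponse (hβ : 0 < β) (hψφ : ∀ x, ψ x ≤ φ x) (S : Set E) :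
    SolvesObstacle Q β ψ φ S (⋂ n, C.innerD β ψ φ S n) (C.bestResponse β ψ φ S) := by
  obtain ⟨n, hn⟩ := exists_forall_ge_eq_iInter (C.antitone_innerD (β := β) (ψ := ψ) (φ := φ) S)
  set D := ⋂ n, C.innerD β ψ φ S n
  have hD : C.innerD β ψ φ S n = D := hn n le_rfl
  have hDS : Disjoint D S := hD ▸ C.disjoint_innerD S n
  obtain ⟨u, hu, huD, huS, hu0⟩ := C.exists_payoff_hit_eq (ψ := ψ) (φ := φ) hβ hDS
  have hψu : ∀ x, ψ x ≤ u x := fun x => by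
    rw [← hu x, ← hD]; exact C.le_payoff_innerD hβ hψφ S n x
  have hsuper : ∀ x ∉ S, genSub Q β u x ≤ 0 := fun x hx => by
    by_cases hxD : x ∈ D
    · have h := hxD
      -- Stability under one more improvement is exactly superharmonicity on `D`.
      rw [← hn (n + 1) n.le_succ, innerD, hD, funext hu] at h
      exact h.1
    · exact (hu0 x fun h => h.elim hxD hx).le
  have hbest : C.bestResponse β ψ φ S = u := funext fun x => le_antisymm
    (ciSup_le fun τ => C.payoff_le hβ τ.2 (C.isStoppingTime_hit S)
      (fun ω s _ h => hsuper _ (C.notMem_of_lt_hit h)) (fun ω t _ _ => hψu _)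
      (fun ω t h _ => (huS _ (C.hit_mem h)).ge) x)
    ((hu x).symm.trans_le (le_ciSup (C.bddAbove_payoff hβ x (C.hit S))
      ⟨C.hit D, C.isStoppingTime_hit D⟩))
  rw [hbest]
  exact ⟨hDS, huS, huD, hψu, hsuper, hu0⟩

/-- Hitting the empty set takes forever, so `φ` is never paid. The one-player problem thus falls
under the same obstacle theory. -/
lemma V₀_eq_bestResponse_empty : C.V₀ β ψ = C.bestResponse β ψ φ ∅ := by
  ext x
  simp [V₀, bestResponse, payoff, hit]

/-! ### The outer iteration -/

lemma solvesObstacle_seqD (hβ : 0 < β) (hψφ : ∀ x, ψ x ≤ φ x) (k : ℕ) :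
    SolvesObstacle Q β ψ φ (C.seqS β ψ φ k) (C.seqD β ψ φ k)
      (C.bestResponse β ψ φ (C.seqS β ψ φ k)) :=
  C.solvesObstacle_bestResponse hβ hψφ _

lemma contact_subset_seqS (k : ℕ) : {x | φ x = ψ x} ⊆ C.seqS β ψ φ k := by
  cases k <;> exact Set.subset_union_right

lemma antitone_seqS : Antitone (C.seqS β ψ φ) :=
  antitone_nat_of_succ_le fun k => Set.union_subset Set.inter_subset_left (C.contact_subset_seqS k)

lemma bestResponse_seqS_succ_le (hβ : 0 < β) (hψφ : ∀ x, ψ x ≤ φ x) (k : ℕ) (x : E) :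
    C.bestResponse β ψ φ (C.seqS β ψ φ (k + 1)) x ≤ C.bestResponse β ψ φ (C.seqS β ψ φ k) x := by
  have hk := C.solvesObstacle_seqD hβ hψφ k
  refine (C.solvesObstacle_seqD hβ hψφ (k + 1)).le C.isMarkovGenerator hβ
    (fun z hz => (hk.eq_upper z (C.antitone_seqS k.le_succ hz)).ge) hk.lower_le (fun z hz => ?_) x
  by_cases hzk : z ∈ C.seqS β ψ φ k
  · by_contra! hpos
    exact hz (Or.inl ⟨hzk, hpos.le⟩)
  · exact hk.superharmonic z hzk

lemma antitone_bestResponse_seqS (hβ : 0 < β) (hψφ : ∀ x, ψ x ≤ φ x) (x : E) :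
    Antitone fun k => C.bestResponse β ψ φ (C.seqS β ψ φ k) x :=
  antitone_nat_of_succ_le fun k => C.bestResponse_seqS_succ_le hβ hψφ k x

/-- By monotonicity only the first set matters. There `V₀` is a supersolution, because `V₀ ≥ φ` on
that set; off it `V₀ ≤ φ` by definition. -/
lemma bestResponse_seqS_le (hβ : 0 < β) (hψφ : ∀ x, ψ x ≤ φ x) (k : ℕ) (x : E) :
    C.bestResponse β ψ φ (C.seqS β ψ φ k) x ≤ φ x := by
  refine (C.antitone_bestResponse_seqS hβ hψφ x (Nat.zero_le k)).trans ?_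
  have h0 := C.solvesObstacle_seqD hβ hψφ 0
  by_cases hx : x ∈ C.seqS β ψ φ 0
  · exact (h0.eq_upper x hx).le
  have hV := C.solvesObstacle_bestResponse hβ hψφ ∅
  rw [← C.V₀_eq_bestResponse_empty] at hV
  refine (h0.le C.isMarkovGenerator hβ (f := C.V₀ β ψ) ?_ hV.lower_le
    (fun z _ => hV.superharmonic z (Set.notMem_empty z)) x).trans
    (not_lt.1 fun h => hx (Or.inl h))
  rintro z (hz | hz)
  · exact le_of_lt hz
  · exact (show φ z = ψ z from hz).trans_le (hV.lower_le z)

/-- The outer iteration stabilizes. -/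
theorem exists_seqS_eq_limS : ∃ k, ∀ m ≥ k, C.seqS β ψ φ m = C.limS β ψ φ :=
  exists_forall_ge_eq_iInter C.antitone_seqS

lemma genSub_bestResponse_limS_nonneg {x : E} (hx : x ∈ C.limS β ψ φ) (hne : φ x ≠ ψ x) :
    0 ≤ genSub Q β (C.bestResponse β ψ φ (C.limS β ψ φ)) x := by
  obtain ⟨k, hk⟩ := C.exists_seqS_eq_limS (β := β) (ψ := ψ) (φ := φ)
  rw [← hk (k + 1) k.le_succ, seqS, hk k le_rfl] at hx
  exact hx.elim (fun h => h.2) fun h => absurd h hne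

/-! ### The value of the game and its verification conditions. -/

lemma lowerValue_le_upperValue (hβ : 0 < β) (x : E) :
    C.lowerValue β ψ φ x ≤ C.upperValue β ψ φ x :=
  ciSup_le fun τ => le_ciInf fun γ =>
    (ciInf_le (C.bddBelow_payoff hβ x τ) γ).trans (le_ciSup (C.bddAbove_payoff hβ x γ) τ)

theorem upperValue_le_bestResponse (hβ : 0 < β) (S : Set E) (x : E) :
    C.upperValue β ψ φ x ≤ C.bestResponse β ψ φ S x := by
  refine ciInf_le (f := fun γ : C.StoppingTimes => ⨆ τ : C.StoppingTimes, C.payoff β ψ φ x τ γ)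
    ⟨-(∑ y, |ψ y| + ∑ y, |φ y|), ?_⟩ ⟨C.hit S, C.isStoppingTime_hit S⟩
  rintro _ ⟨γ, rfl⟩
  exact (abs_le.1 (C.abs_payoff_le hβ x)).1.trans
    (le_ciSup (C.bddAbove_payoff hβ x γ) (Classical.arbitrary _))

theorem bestResponse_limS_le_lowerValue (hβ : 0 < β) (hψφ : ∀ x, ψ x ≤ φ x) (x : E) :
    C.bestResponse β ψ φ (C.limS β ψ φ) x ≤ C.lowerValue β ψ φ x := by
  obtain ⟨k, hk⟩ := C.exists_seqS_eq_limS (β := β) (ψ := ψ) (φ := φ)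
  have hobs := C.solvesObstacle_seqD hβ hψφ k
  have hle := C.bestResponse_seqS_le hβ hψφ k
  have hcontact := C.contact_subset_seqS (β := β) (ψ := ψ) (φ := φ) k
  rw [hk k le_rfl] at hobs hle hcontact
  -- The contact set is added because subharmonicity of the best response on `limS` is known only
  -- away from it; stopping there costs nothing, as `φ = ψ`.
  set D := C.seqD β ψ φ k ∪ {x | φ x = ψ x}
  refine le_ciSup_of_le (f := fun τ : C.StoppingTimes =>
    ⨅ γ : C.StoppingTimes, C.payoff β ψ φ x τ γ)
    ⟨∑ y, |ψ y| + ∑ y, |φ y|, ?_⟩ ⟨C.hit D, C.isStoppingTime_hit D⟩ (le_ciInf fun γ => ?_)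
  · rintro _ ⟨τ, rfl⟩
    exact (ciInf_le (C.bddBelow_payoff hβ x τ) (Classical.arbitrary _)).trans
      (abs_le.1 (C.abs_payoff_le hβ x)).2
  · refine C.le_payoff hβ (C.isStoppingTime_hit D) γ.2 (fun ω s hs _ => ?_) (fun ω t ht _ => ?_)
      (fun ω t _ _ => hle _) x
    · have hD := C.notMem_of_lt_hit hs
      by_cases hS : C.X s ω ∈ C.limS β ψ φ
      · exact C.genSub_bestResponse_limS_nonneg hS fun h => hD (Or.inr h)
      · exact (hobs.harmonic _ fun h => h.elim (fun h => hD (Or.inl h)) hS).ge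
    · rcases C.hit_mem ht with h | h
      · exact (hobs.eq_lower _ h).le
      · exact (hle _).trans_eq h

/-- The game has a value, namely the best response to the hitting time of `S_∞`. -/
theorem isValueFunction_bestResponse_limS (hβ : 0 < β) (hψφ : ∀ x, ψ x ≤ φ x) :
    C.IsValueFunction β ψ φ (C.bestResponse β ψ φ (C.limS β ψ φ)) := fun x =>
  ⟨le_antisymm ((C.lowerValue_le_upperValue hβ x).trans (C.upperValue_le_bestResponse hβ _ x))
    (C.bestResponse_limS_le_lowerValue hβ hψφ x),
   le_antisymm (C.upperValue_le_bestResponse hβ _ x)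
    ((C.bestResponse_limS_le_lowerValue hβ hψφ x).trans (C.lowerValue_le_upperValue hβ x))⟩

lemma disjoint_limD_limS (hβ : 0 < β) (hψφ : ∀ x, ψ x ≤ φ x) :
    Disjoint (C.limD β ψ φ) (C.limS β ψ φ) :=
  Set.disjoint_iUnion_left.2 fun k =>
    Set.disjoint_of_subset_right (Set.iInter_subset _ k) (C.solvesObstacle_seqD hβ hψφ k).disjoint

theorem verificationConditions_bestResponse_limS (hβ : 0 < β) (hψφ : ∀ x, ψ x ≤ φ x) :
    VerificationConditions Q β ψ φ (C.bestResponse β ψ φ (C.limS β ψ φ)) (C.limD β ψ φ)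
      (C.limS β ψ φ ∩ {x | ψ x < φ x}) := by
  obtain ⟨k, hk⟩ := C.exists_seqS_eq_limS (β := β) (ψ := ψ) (φ := φ)
  have hobs := C.solvesObstacle_seqD hβ hψφ k
  have hle := C.bestResponse_seqS_le hβ hψφ k
  rw [hk k le_rfl] at hobs hle
  refine ⟨fun x hx => ⟨?_, ?_⟩, fun x hx => ⟨?_, hobs.eq_upper x hx.1⟩, fun x hx => ?_,
    fun x => ⟨hobs.lower_le x, hle x⟩⟩
  · exact hobs.superharmonic x ((C.disjoint_limD_limS hβ hψφ).notMem_of_mem_left hx)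
  · obtain ⟨j, hj⟩ := Set.mem_iUnion.1 hx
    refine le_antisymm ?_ (hobs.lower_le x)
    -- At a state of an earlier `D_j` the `j`-th best response already equals `ψ`, and later ones
    -- only decrease while staying above `ψ`.
    rw [← (C.solvesObstacle_seqD hβ hψφ j).eq_lower x hj, ← hk (max j k) (le_max_right _ _)]
    exact C.antitone_bestResponse_seqS hβ hψφ x (le_max_left _ _)
  · exact C.genSub_bestResponse_limS_nonneg hx.1 (ne_of_gt hx.2)
  · refine hobs.harmonic x ?_
    rintro (h | h)
    · exact hx (Or.inl (Or.inl (Set.mem_iUnion.2 ⟨k, h⟩)))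
    · rcases (hψφ x).lt_or_eq with h' | h'
      · exact hx (Or.inl (Or.inr ⟨h, h'⟩))
      · exact hx (Or.inr h'.symm)

end MarkovChain

end StoppingGame


/-- The game has a value function, and the value function satisfies the verification conditions for
disjoint sets `A`, `B`, both disjoint from `{φ = ψ}`, namely `A = D_∞` and `B = S_∞ ∩ {φ > ψ}`. -/
theorem corollary3p8 {Ω : Type*} [MeasurableSpace Ω] {E : Type*} [Fintype E]
    [TopologicalSpace E] [DiscreteTopology E] [MeasurableSpace E] [BorelSpace E]
    (Q : Matrix E E ℝ) (C : StoppingGame.MarkovChain Ω Q) (β : ℝ) (hβ : 0 < β)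
    (ψ φ : E → ℝ) (hψ : ∀ x, 0 ≤ ψ x) (hψφ : ∀ x, ψ x ≤ φ x) :
    (∃ V : E → ℝ, C.IsValueFunction β ψ φ V) ∧
    ∀ V : E → ℝ, C.IsValueFunction β ψ φ V →
      ∃ A B : Set E,
        A = C.limD β ψ φ ∧ B = C.limS β ψ φ ∩ {x | ψ x < φ x} ∧
        Disjoint A B ∧ Disjoint A {x | φ x = ψ x} ∧ Disjoint B {x | φ x = ψ x} ∧
        StoppingGame.VerificationConditions Q β ψ φ V A B := by
  have hval := C.isValueFunction_bestResponse_limS hβ hψφ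
  refine ⟨⟨_, hval⟩, fun V hV => ⟨_, _, rfl, rfl, ?_, ?_, ?_, ?_⟩⟩
  · exact Set.disjoint_of_subset_right Set.inter_subset_left (C.disjoint_limD_limS hβ hψφ)
  · exact Set.disjoint_of_subset_right (Set.subset_iInter C.contact_subset_seqS)
      (C.disjoint_limD_limS hβ hψφ)
  · exact Set.disjoint_left.2 fun x hx h => (ne_of_gt hx.2) h
  · obtain rfl : V = C.bestResponse β ψ φ (C.limS β ψ φ) :=
      funext fun x => (hV x).1.symm.trans (hval x).1
    exact C.verificationConditions_bestResponse_limS hβ hψφ
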